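/- Let $p$ be a prime. A group $K$ is called residually a finite $p$-group if for every $g\in K$ with $g\neq 1$ there is a normal subgroup $N$ of $K$ such that $g\notin N$ and $K/N$ is a finite $p$-group. Proposition. Suppose that $G$ is a finitely generated group that is residually a finite $p$-group. Let $u\in G$ be an element of infinite order whose centralizer in $G$ is $C_G(u)=\langle u\rangle$. Then for every integer $n\geq 0$ the group $$H:=G*_{(u=x^{p^n})}\langle x\rangle,$$ that is, the free product of $G$ and an infinite cyclic group $\langle x\rangle$ with the infinite cyclic subgroups $\langle u\rangle\leq G$ and $\langle x^{p^n}\rangle\leq\langle x\rangle$ amalgamated by identifying $u$ with $x^{p^n}$, is residually a finite $p$-group. -/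

import Mathlib

universe u

/-- A group `G` is residually a finite `p`-group if for every `g ≠ 1` there is a normal subgroup
`N` of `G` that does not contain `g` and for which `G ⧸ N` is a finite `p`-group. -/
def IsResiduallyFinitePGroup (p : ℕ) (G : Type*) [Group G] : Prop :=
  ∀ g : G, g ≠ 1 → ∃ (N : Subgroup G) (_ : N.Normal),
    Finite (G ⧸ N) ∧ IsPGroup p (G ⧸ N) ∧ g ∉ N

namespace RootAmalgam

/-- The infinite cyclic group `⟨x⟩`, lifted to the universe of the other factor. -/
abbrev Cyc : Type u := ULift.{u} (Multiplicative ℤ)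

/-- The generator `x` of the infinite cyclic group `⟨x⟩`. -/
def gen : Cyc.{u} := ULift.up (Multiplicative.ofAdd 1)

/-- The two factors of the amalgamated product: `G` and `⟨x⟩`. -/
def Factor (G : Type u) : Bool → Type u
  | true => G
  | false => Cyc.{u}

instance instGroupFactor (G : Type u) [Group G] : ∀ b : Bool, Group (Factor G b)
  | true => inferInstanceAs (Group G)
  | false => inferInstanceAs (Group Cyc.{u})

/-- The two maps from the infinite cyclic group along which the factors are amalgamated: the
generator of `ℤ` goes to `v` in `G` and to `x ^ m` in `⟨x⟩`. -/
def toFactor {G : Type u} [Group G] (v : G) (m : ℕ) :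
    ∀ b : Bool, Multiplicative ℤ →* Factor G b
  | true => zpowersHom G v
  | false => zpowersHom Cyc.{u} (gen ^ m)

end RootAmalgam

/-- The group `G *_{v = x ^ m} ⟨x⟩` with `x` of infinite order: the pushout of `G` and the
infinite cyclic group `⟨x⟩`, the element `v` of `G` being identified with `x ^ m`. If `v` has
infinite order and `m ≠ 0`, it is the free product of `G` and `⟨x⟩` with the infinite cyclic
subgroups `⟨v⟩` and `⟨x ^ m⟩` amalgamated by `v = x ^ m`. -/
abbrev RootAmalgam {G : Type u} [Group G] (v : G) (m : ℕ) : Type u :=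
  Monoid.PushoutI (RootAmalgam.toFactor v m)

/-!
The proof reduces to finite `p`-groups and then uses covering-space style extensions in place of
the Bass–Serre theory of amalgams.

An element of the amalgam `H` is the product of a power of `u` and a reduced word `w`, whose letters
lie alternately in `G ∖ ⟨u⟩` and in `⟨x⟩ ∖ ⟨x ^ pⁿ⟩`. If `w` is empty, it suffices to detect a power
of `u`; otherwise it suffices to find a homomorphism `ψ` from `H` to a finite `p`-group with
`ψ w ∉ ψ ⟨u⟩`.

* Single letters. A letter `g ∈ G ∖ ⟨u⟩` does not centralize `u`, so that the commutator `⁅g, u⁆`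
  survives in some finite `p`-quotient of `G`, and there `g` does not fall into the image of `⟨u⟩`,
  since this image is commutative. Such a quotient `P` embeds diagonally into the wreath product
  `P ≀ᵣ ℤ/pⁿ`, where the image of `u` has a `pⁿ`-th root that maps to a generator of `ℤ/pⁿ`
  (`RegularWreathProduct.root_pow`). This gives a homomorphism on `H` (`RootAmalgam.toWreath`) under
  which no letter of `w` falls into the image of `⟨u⟩`.

* Longer words. Let `ψ : H → Q` be given, and let `V ≤ Q` be the image of the amalgamated subgroup.
  The indicator function `m` of `V`, with values in a group `D` of order `p`, lies in the base group
  of `D ≀ᵣ Q` and commutes with `V`. Hence `ψ` on one factor and its conjugate by `m` on the other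
  glue to a homomorphism `H → D ≀ᵣ Q` (`Monoid.PushoutI.deform`). Its component in the base group
  records, for a word, the edges of the graph of cosets of `V` that the path of the word traverses.
  If `ψ` keeps all subwords of length at most `L` outside `V`, then a word of length `L + 1` that
  falls into `V` describes a simple closed path, whose class in the homology with coefficients in `D`
  is nonzero (`Monoid.PushoutI.deform_left_ne_one`). Thus the new homomorphism keeps all subwords of
  length at most `L + 1` outside the image of the amalgamated subgroup, and induction on `L` applies
  (`Monoid.PushoutI.exists_hom_word_notMem`).
-/

open Monoid
open scoped commutatorElement

/-! ### Finite `p`-groups as targets -/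

theorem IsPGroup.prod {p : ℕ} [Fact p.Prime] {P Q : Type*} [Group P] [Group Q] [Finite P] [Finite Q]
    (hP : IsPGroup p P) (hQ : IsPGroup p Q) : IsPGroup p (P × Q) := by
  obtain ⟨a, ha⟩ := IsPGroup.iff_card.1 hP
  obtain ⟨b, hb⟩ := IsPGroup.iff_card.1 hQ
  exact IsPGroup.of_card (n := a + b) (by rw [Nat.card_prod, ha, hb, pow_add])

theorem IsPGroup.regularWreathProduct {p : ℕ} [Fact p.Prime] {D Q : Type*} [Group D] [Group Q]
    [Finite D] [Finite Q] (hD : IsPGroup p D) (hQ : IsPGroup p Q) : IsPGroup p (D ≀ᵣ Q) := by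
  obtain ⟨a, ha⟩ := IsPGroup.iff_card.1 hD
  obtain ⟨b, hb⟩ := IsPGroup.iff_card.1 hQ
  exact IsPGroup.of_card (n := a * p ^ b + b)
    (by rw [RegularWreathProduct.card, ha, hb, pow_add, pow_mul])

theorem isPGroup_multiplicative_zmod (p n : ℕ) : IsPGroup p (Multiplicative (ZMod (p ^ n))) :=
  IsPGroup.of_card (n := n) (by
    rw [Nat.card_congr Multiplicative.toAdd, Nat.card_zmod])

theorem isResiduallyFinitePGroup_of_hom {p : ℕ} {G : Type*} [Group G]
    (h : ∀ g : G, g ≠ 1 → ∃ (Q : Type*) (_ : Group Q) (_ : Finite Q) (ψ : G →* Q),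
      IsPGroup p Q ∧ ψ g ≠ 1) : IsResiduallyFinitePGroup p G := by
  intro g hg
  obtain ⟨Q, _, _, ψ, hQ, hψ⟩ := h g hg
  have hinj := QuotientGroup.kerLift_injective ψ
  exact ⟨ψ.ker, inferInstance, Finite.of_injective _ hinj, hQ.of_injective _ hinj, hψ⟩

theorem IsResiduallyFinitePGroup.exists_hom_forall_mem_list {p : ℕ} [Fact p.Prime] {G : Type u}
    [Group G] (hG : IsResiduallyFinitePGroup p G) (S : List G) (hS : ∀ s ∈ S, s ≠ 1) :
    ∃ (Q : Type u) (_ : Group Q) (_ : Finite Q) (ψ : G →* Q),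
      IsPGroup p Q ∧ ∀ s ∈ S, ψ s ≠ 1 := by
  induction S with
  | nil => exact ⟨PUnit, inferInstance, inferInstance, 1, IsPGroup.of_subsingleton p PUnit, by simp⟩
  | cons s S ih =>
    obtain ⟨Q, _, _, ψ, hQ, hψ⟩ := ih fun t ht => hS t (List.mem_cons_of_mem s ht)
    obtain ⟨N, _, _, hN, hsN⟩ := hG s (hS s List.mem_cons_self)
    refine ⟨(G ⧸ N) × Q, inferInstance, inferInstance, (QuotientGroup.mk' N).prod ψ, hN.prod hQ, ?_⟩
    intro t ht h
    rw [MonoidHom.prod_apply, Prod.mk_eq_one] at h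
    rcases List.mem_cons.1 ht with rfl | ht
    · exact hsN ((QuotientGroup.eq_one_iff t).1 h.1)
    · exact hψ t ht h.2

/-! ### Roots in wreath products -/

namespace RegularWreathProduct

variable {P Q : Type*} [Group P] [Group Q]

/-- The diagonal embedding of `P` into the base group of `P ≀ᵣ Q`. -/
def diag : P →* P ≀ᵣ Q where
  toFun a := ⟨fun _ => a, 1⟩
  map_one' := rfl
  map_mul' a b := by ext <;> simp

@[simp]
theorem diag_left (a : P) (x : Q) : (diag a : P ≀ᵣ Q).left x = a := rfl

@[simp]
theorem diag_right (a : P) : (diag a : P ≀ᵣ Q).right = 1 := rfl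

theorem diag_injective : Function.Injective (diag : P → P ≀ᵣ Q) := fun a b h => by
  simpa using congrArg (fun w => w.left 1) h

theorem pow_right (w : P ≀ᵣ Q) (k : ℕ) : (w ^ k).right = w.right ^ k :=
  map_pow rightHom w k

theorem zpow_right (w : P ≀ᵣ Q) (k : ℤ) : (w ^ k).right = w.right ^ k :=
  map_zpow rightHom w k

open Classical in
/-- The element `((a, 1, …, 1), σ)` of `P ≀ᵣ ℤ/N`, with `σ` the generator of `ℤ/N`. -/
noncomputable def root (N : ℕ) (a : P) : P ≀ᵣ Multiplicative (ZMod N) :=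
  ⟨fun x => if x = 1 then a else 1, Multiplicative.ofAdd 1⟩

theorem root_pow_left (N : ℕ) [NeZero N] (a : P) (k : ℕ) (hk : k ≤ N)
    (x : Multiplicative (ZMod N)) :
    (root N a ^ k).left x = if x.toAdd.val < k then a else 1 := by
  induction k with
  | zero => simp
  | succ k ih =>
    have hval : ((root N a ^ k).right⁻¹ * x = 1) ↔ x.toAdd.val = k := by
      rw [inv_mul_eq_one, pow_right, root, ← ofAdd_nsmul, nsmul_one]
      constructor
      · rintro rfl
        exact ZMod.val_cast_of_lt hk
      · intro h
        rw [← h, ZMod.natCast_zmod_val, ofAdd_toAdd]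
    have hroot : (root N a).left ((root N a ^ k).right⁻¹ * x)
        = if x.toAdd.val = k then a else 1 := by
      rw [← ite_congr (propext hval) (fun _ => rfl) (fun _ => rfl)]
      rfl
    rw [pow_succ, mul_left, Pi.mul_apply, ih (by omega), hroot]
    split_ifs <;> first | omega | simp

theorem root_pow (N : ℕ) [NeZero N] (a : P) : root N a ^ N = diag a := by
  ext x
  · rw [root_pow_left N a N le_rfl, if_pos (ZMod.val_lt _), diag_left]
  · rw [pow_right, root, ← ofAdd_nsmul, nsmul_one, ZMod.natCast_self, ofAdd_zero, diag_right]

end RegularWreathProduct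

/-! ### Deforming homomorphisms on an amalgam -/

namespace Monoid.PushoutI

variable {ι : Type*} {F : ι → Type*} [∀ i, Group (F i)] {K : Type*} [Group K]
  {φ : ∀ i, K →* F i} {D Q : Type*} [Group D] [Group Q]

/-- The element of the amalgam that a list of letters from the factors represents. -/
def wordProd (φ : ∀ i, K →* F i) (l : List (Σ i, F i)) : PushoutI φ :=
  (l.map fun c => of c.1 c.2).prod

@[simp]
theorem wordProd_nil : wordProd φ [] = 1 := rfl

@[simp]
theorem wordProd_cons (c : Σ i, F i) (l : List (Σ i, F i)) :
    wordProd φ (c :: l) = of c.1 c.2 * wordProd φ l := by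
  simp [wordProd]

/-- The image in `Q` of the amalgamated subgroup. -/
abbrev baseImage (ψ : PushoutI φ →* Q) : Subgroup Q := (ψ.comp (base φ)).range

open Classical in
/-- The element of the base group of `D ≀ᵣ Q` with the value `d` on the image of the amalgamated
subgroup and `1` elsewhere. -/
noncomputable def indicator (ψ : PushoutI φ →* Q) (d : D) : D ≀ᵣ Q :=
  ⟨fun x => if x ∈ baseImage ψ then d else 1, 1⟩

theorem indicator_left_of_mem (ψ : PushoutI φ →* Q) (d : D) {x : Q} (hx : x ∈ baseImage ψ) :
    (indicator ψ d).left x = d := if_pos hx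

theorem indicator_left_of_notMem (ψ : PushoutI φ →* Q) (d : D) {x : Q} (hx : x ∉ baseImage ψ) :
    (indicator ψ d).left x = 1 := if_neg hx

theorem commute_indicator (ψ : PushoutI φ →* Q) (d : D) {q : Q} (hq : q ∈ baseImage ψ) :
    Commute (indicator ψ d) (RegularWreathProduct.inl q) := by
  classical
  ext x
  · have h : q⁻¹ * x ∈ baseImage ψ ↔ x ∈ baseImage ψ :=
      Subgroup.mul_mem_cancel_left _ (inv_mem hq)
    simp only [indicator, RegularWreathProduct.mul_left, RegularWreathProduct.left_inl,
      RegularWreathProduct.right_inl, Pi.mul_apply, Pi.one_apply, mul_one, one_mul]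
    exact if_congr h.symm rfl rfl
  · simp [indicator]

open Classical in
/-- The homomorphism to `D ≀ᵣ Q` that agrees with `ψ` on all factors but `F j`, and with the
conjugate of `ψ` by `indicator ψ d` on `F j`. -/
noncomputable def deform (ψ : PushoutI φ →* Q) (d : D) (j : ι) : PushoutI φ →* D ≀ᵣ Q :=
  lift
    (fun i => if i = j then
      (MulAut.conj (indicator ψ d)).toMonoidHom.comp
        (RegularWreathProduct.inl.comp (ψ.comp (of i)))
      else RegularWreathProduct.inl.comp (ψ.comp (of i)))
    (RegularWreathProduct.inl.comp (ψ.comp (base φ)))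
    (fun i => by
      ext1 k
      split_ifs
      · have h := commute_indicator ψ d (q := ψ (base φ k)) ⟨k, rfl⟩
        simpa [of_apply_eq_base, mul_inv_eq_iff_eq_mul] using h.eq
      · simp [of_apply_eq_base])

theorem deform_base (ψ : PushoutI φ →* Q) (d : D) (j : ι) (k : K) :
    deform ψ d j (base φ k) = RegularWreathProduct.inl (ψ (base φ k)) := by
  simp [deform]

theorem deform_of_ne (ψ : PushoutI φ →* Q) (d : D) {i j : ι} (h : i ≠ j) (g : F i) :
    deform ψ d j (of i g) = RegularWreathProduct.inl (ψ (of i g)) := by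
  simp [deform, h]

theorem deform_of_self (ψ : PushoutI φ →* Q) (d : D) (j : ι) (g : F j) :
    deform ψ d j (of j g) =
      indicator ψ d * RegularWreathProduct.inl (ψ (of j g)) * (indicator ψ d)⁻¹ := by
  simp [deform]

theorem deform_right (ψ : PushoutI φ →* Q) (d : D) (j : ι) (g : PushoutI φ) :
    (deform ψ d j g).right = ψ g := by
  induction g using PushoutI.induction_on with
  | of i g =>
    by_cases h : i = j
    · subst h
      simp [deform_of_self, indicator]
    · simp [deform_of_ne ψ d h]
  | base k => simp [deform_base]
  | mul x y hx hy => simp [hx, hy]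

theorem deform_left_mul (ψ : PushoutI φ →* Q) (d : D) (j : ι) (g h : PushoutI φ) (x : Q) :
    (deform ψ d j (g * h)).left x
      = (deform ψ d j g).left x * (deform ψ d j h).left ((ψ g)⁻¹ * x) := by
  simp [deform_right]

theorem deform_left_of_ne (ψ : PushoutI φ →* Q) (d : D) {i j : ι} (h : i ≠ j) (g : F i) (x : Q) :
    (deform ψ d j (of i g)).left x = 1 := by
  simp [deform_of_ne ψ d h]

theorem deform_left_of_self (ψ : PushoutI φ →* Q) (d : D) (j : ι) (g : F j) (x : Q) :
    (deform ψ d j (of j g)).left x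
      = (indicator ψ d).left x * ((indicator ψ d).left ((ψ (of j g))⁻¹ * x))⁻¹ := by
  simp [deform_of_self, indicator]

theorem deform_left_of_eq_one (ψ : PushoutI φ →* Q) (d : D) (j i : ι) (g : F i) {x : Q}
    (hx : x ∉ baseImage ψ) (hgx : (ψ (of i g))⁻¹ * x ∉ baseImage ψ) :
    (deform ψ d j (of i g)).left x = 1 := by
  by_cases h : i = j
  · subst h
    simp [deform_left_of_self, indicator_left_of_notMem ψ d hx, indicator_left_of_notMem ψ d hgx]
  · exact deform_left_of_ne ψ d h g x

/-- The coset of `x` does not contribute to the deformation of a word whose path avoids it. -/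
theorem deform_left_wordProd_eq_one (ψ : PushoutI φ →* Q) (d : D) (j : ι) (l : List (Σ i, F i))
    (x : Q) (hx : ∀ q, q <+: l → (ψ (wordProd φ q))⁻¹ * x ∉ baseImage ψ) :
    (deform ψ d j (wordProd φ l)).left x = 1 := by
  induction l generalizing x with
  | nil => simp
  | cons c l ih =>
    rw [wordProd_cons, deform_left_mul, deform_left_of_eq_one, ih, one_mul]
    · intro q hq
      simpa [mul_assoc] using hx (c :: q) (List.prefix_cons_inj c |>.2 hq)
    · simpa using hx [] (List.nil_prefix)
    · simpa using hx [c] (List.prefix_cons_inj c |>.2 (List.nil_prefix))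

/-- The edge between the first two letters of a word is traversed exactly once if the path of the
word does not return to it; exactly one of its two neighbouring letters is deformed, so that its
coefficient in the deformation is `d` or `d⁻¹`. -/
theorem deform_left_ne_one (ψ : PushoutI φ →* Q) {d : D} (hd : d ≠ 1) {j : ι} {c₁ c₂ : Σ i, F i}
    {l : List (Σ i, F i)} (hj : c₁.1 = j ∧ c₂.1 ≠ j ∨ c₁.1 ≠ j ∧ c₂.1 = j)
    (hc₁ : ψ (of c₁.1 c₁.2) ∉ baseImage ψ)
    (hl : ∀ q, q <+: l → ψ (wordProd φ (c₂ :: q)) ∉ baseImage ψ) :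
    (deform ψ d j (wordProd φ (c₁ :: c₂ :: l))).left (ψ (of c₁.1 c₁.2)) ≠ 1 := by
  have htail : (deform ψ d j (wordProd φ l)).left ((ψ (of c₂.1 c₂.2))⁻¹ * 1) = 1 := by
    refine deform_left_wordProd_eq_one ψ d j l _ fun q hq h => hl q hq ?_
    simpa using inv_mem h
  have hc₂ : (ψ (of c₂.1 c₂.2))⁻¹ ∉ baseImage ψ := fun h => hl [] List.nil_prefix (by
    simpa using inv_mem h)
  have hone : (1 : Q) ∈ baseImage ψ := one_mem _
  rw [wordProd_cons, wordProd_cons, deform_left_mul, deform_left_mul, inv_mul_cancel, htail, mul_one]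
  obtain ⟨i₁, g₁⟩ := c₁
  obtain ⟨i₂, g₂⟩ := c₂
  rcases hj with ⟨rfl, h₂⟩ | ⟨h₁, rfl⟩
  · rw [deform_left_of_ne ψ d h₂, deform_left_of_self, inv_mul_cancel,
      indicator_left_of_mem ψ d hone, indicator_left_of_notMem ψ d hc₁]
    simpa using hd
  · rw [deform_left_of_ne ψ d h₁, deform_left_of_self, mul_one,
      indicator_left_of_mem ψ d hone, indicator_left_of_notMem ψ d hc₂]
    simpa using hd

/-! ### Separating reduced words from the amalgamated subgroup -/

/-- If some homomorphism from an amalgam of two groups to a finite `p`-group keeps the letters of a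
reduced word outside the image of the amalgamated subgroup, then some other one does so with the
word itself. -/
theorem exists_hom_word_notMem {p : ℕ} [Fact p.Prime] {F : Bool → Type*} [∀ b, Group (F b)]
    {φ : ∀ b, K →* F b} {Q₀ : Type u} [Group Q₀] [Finite Q₀] (hQ₀ : IsPGroup p Q₀)
    (ψ₀ : PushoutI φ →* Q₀) {w : List (Σ b, F b)} (hw : w ≠ [])
    (hchain : w.IsChain fun c c' => c.1 ≠ c'.1)
    (hletter : ∀ c ∈ w, ψ₀ (of c.1 c.2) ∉ baseImage ψ₀) :
    ∃ (Q : Type u) (_ : Group Q) (_ : Finite Q) (ψ : PushoutI φ →* Q),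
      IsPGroup p Q ∧ ψ (wordProd φ w) ∉ baseImage ψ := by
  -- Passing to all subwords of bounded length makes induction on the length bound possible.
  suffices H : ∀ L : ℕ, ∃ (Q : Type u) (_ : Group Q) (_ : Finite Q) (ψ : PushoutI φ →* Q),
      IsPGroup p Q ∧ ∀ v, v <:+: w → v ≠ [] → v.length ≤ L + 1 →
        ψ (wordProd φ v) ∉ baseImage ψ by
    obtain ⟨Q, hg, hf, ψ, hQ, hψ⟩ := H w.length
    exact ⟨Q, hg, hf, ψ, hQ, hψ w List.infix_rfl hw (by omega)⟩
  intro L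
  induction L with
  | zero =>
    refine ⟨Q₀, inferInstance, inferInstance, ψ₀, hQ₀, ?_⟩
    rintro (_ | ⟨c, _ | ⟨c', v⟩⟩) hv hne hlen
    · exact absurd rfl hne
    · simpa using hletter c (hv.subset List.mem_cons_self)
    · simp at hlen
  | succ L ih =>
    obtain ⟨Q, _, _, ψ, hQ, hψ⟩ := ih
    -- The group `D` of order `p` is written with `p ^ 1` to share a lemma with `ℤ/pⁿ`.
    let d : Multiplicative (ZMod (p ^ 1)) := Multiplicative.ofAdd 1
    have : Fact (1 < p ^ 1) := ⟨by simpa using (Fact.out : p.Prime).one_lt⟩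
    have : NeZero (p ^ 1) := ⟨(Nat.lt_trans Nat.zero_lt_one this.out).ne'⟩
    have hd : d ≠ 1 := fun h => one_ne_zero (α := ZMod (p ^ 1)) (Multiplicative.ofAdd.injective h)
    have hfin : Finite (Multiplicative (ZMod (p ^ 1))) := inferInstanceAs (Finite (ZMod (p ^ 1)))
    refine ⟨Multiplicative (ZMod (p ^ 1)) ≀ᵣ Q, inferInstance, inferInstance, deform ψ d false,
      (isPGroup_multiplicative_zmod p 1).regularWreathProduct hQ, ?_⟩
    rintro v hv hne hlen ⟨k, hk⟩
    rw [MonoidHom.comp_apply, deform_base] at hk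
    have hmem : ψ (wordProd φ v) ∈ baseImage ψ := by
      refine ⟨k, ?_⟩
      simpa [deform_right] using congrArg RegularWreathProduct.right hk
    rcases v with _ | ⟨c₁, _ | ⟨c₂, l⟩⟩
    · exact hne rfl
    · exact hψ _ hv hne (by simp) hmem
    · have hc : c₁.1 ≠ c₂.1 := (List.isChain_cons_cons.1 (hchain.infix hv)).1
      refine deform_left_ne_one ψ hd (j := false) (c₁ := c₁) (c₂ := c₂) (l := l) ?_ ?_ ?_ ?_
      · revert hc
        cases c₁.1 <;> cases c₂.1 <;> simp
      · have h₁ : [c₁] <+: c₁ :: c₂ :: l := (List.prefix_cons_inj c₁).2 List.nil_prefix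
        simpa using hψ [c₁] (h₁.isInfix.trans hv) (by simp) (by simp)
      · intro q hq
        have hq' : c₂ :: q <:+: c₁ :: c₂ :: l :=
          ((List.prefix_cons_inj c₂).2 hq).isInfix.trans (List.suffix_cons c₁ _).isInfix
        refine hψ (c₂ :: q) (hq'.trans hv) (by simp) ?_
        have := hq.length_le
        simp only [List.length_cons] at hlen ⊢
        omega
      · rw [← hk]
        rfl

/-- Every element of an amalgam is the product of an element of the amalgamated subgroup and a reduced
word. -/
theorem exists_base_mul_wordProd (hφ : ∀ i, Function.Injective (φ i)) (g : PushoutI φ) :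
    ∃ (k : K) (w : List (Σ i, F i)), g = base φ k * wordProd φ w ∧
      (w.IsChain fun c c' => c.1 ≠ c'.1) ∧ ∀ c ∈ w, c.2 ∉ (φ c.1).range := by
  classical
  obtain ⟨d⟩ := NormalWord.transversal_nonempty φ hφ
  let w : NormalWord d := NormalWord.equiv g
  refine ⟨w.head, w.toList, ?_, w.chain_ne, ?_⟩
  · have hw : w.prod = g := NormalWord.equiv.symm_apply_apply g
    rw [← hw, NormalWord.prod, CoprodI.Word.prod, map_list_prod, List.map_map, wordProd]
    rfl
  · rintro ⟨i, a⟩ hc ha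
    refine w.ne_one _ hc ?_
    have h₁ := ((d.compl i).equiv_snd_eq_self_iff_mem (one_mem _)).2 (w.normalized i a hc)
    have h₂ := ((d.compl i).coe_equiv_snd_eq_one_iff_mem (d.one_mem i)).2 ha
    exact h₁.symm.trans h₂

end Monoid.PushoutI

/-! ### The amalgam of a group with the root of an element -/

namespace RootAmalgam

open PushoutI RegularWreathProduct

variable {G : Type u} [Group G]

theorem toFactor_injective {v : G} (hv : ¬ IsOfFinOrder v) {m : ℕ} (hm : m ≠ 0) (b : Bool) :
    Function.Injective (toFactor v m b) := by
  cases b with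
  | true =>
    intro a b h
    exact Multiplicative.toAdd.injective
      (injective_zpow_iff_not_isOfFinOrder.2 hv h)
  | false =>
    have hgen : ¬ IsOfFinOrder (gen.{u} ^ m) := by
      rw [isOfFinOrder_iff_pow_eq_one]
      rintro ⟨k, hk, h⟩
      have h' := congrArg (fun x : Cyc.{u} => x.down.toAdd) h
      simp [gen] at h'
      omega
    intro a b h
    exact Multiplicative.toAdd.injective
      (injective_zpow_iff_not_isOfFinOrder.2 hgen h)

/-- The extension to the amalgam of a homomorphism `f` from `G` to `P`, with `G` acting through the
diagonal of `P ≀ᵣ ℤ/m` and the generator of the infinite cyclic group sent to an `m`-th root of the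
image of `v`. -/
noncomputable def toWreath {P : Type*} [Group P] (f : G →* P) (v : G) (m : ℕ) [NeZero m] :
    RootAmalgam v m →* P ≀ᵣ Multiplicative (ZMod m) :=
  PushoutI.lift
    (fun b => match b with
      | true => (diag.comp f : G →* P ≀ᵣ Multiplicative (ZMod m))
      | false => ((zpowersHom (P ≀ᵣ Multiplicative (ZMod m)) (root m (f v))).comp
          (MulEquiv.ulift.toMonoidHom : Cyc.{u} →* Multiplicative ℤ)))
    (zpowersHom _ (diag (f v)))
    (fun b => by
      cases b with
      | true =>
        apply MonoidHom.ext_mint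
        change (diag (f (v ^ (1 : ℤ))) : P ≀ᵣ Multiplicative (ZMod m)) = diag (f v) ^ (1 : ℤ)
        simp
      | false =>
        apply MonoidHom.ext_mint
        change root m (f v) ^ (((gen.{u} ^ m) ^ (1 : ℤ)).down.toAdd) = diag (f v) ^ (1 : ℤ)
        simp [gen, root_pow])

variable {P : Type*} [Group P] (f : G →* P) (v : G) (m : ℕ) [NeZero m]

theorem toWreath_of_true (g : G) :
    toWreath f v m (of (φ := toFactor v m) true g) = diag (f g) :=
  PushoutI.lift_of _ _ _ _

theorem toWreath_of_false (x : Cyc.{u}) :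
    toWreath f v m (of (φ := toFactor v m) false x) = root m (f v) ^ x.down.toAdd :=
  PushoutI.lift_of _ _ _ _

theorem toWreath_base (k : Multiplicative ℤ) :
    toWreath f v m (base (toFactor v m) k) = diag (f v ^ k.toAdd) := by
  rw [map_zpow]
  exact PushoutI.lift_base _ _ _ _

theorem toWreath_of_true_notMem {g : G} (hg : f ⁅g, v⁆ ≠ 1) :
    toWreath f v m (of (φ := toFactor v m) true g) ∉ baseImage (toWreath f v m) := by
  rintro ⟨k, hk⟩
  rw [MonoidHom.comp_apply, toWreath_base, toWreath_of_true] at hk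
  refine hg ?_
  rw [map_commutatorElement, ← diag_injective hk]
  exact commutatorElement_eq_one_iff_commute.2 ((Commute.refl _).zpow_left _)

theorem toWreath_of_false_notMem {x : Cyc.{u}} (hx : x ∉ (toFactor v m false).range) :
    toWreath f v m (of (φ := toFactor v m) false x) ∉ baseImage (toWreath f v m) := by
  rintro ⟨k, hk⟩
  rw [MonoidHom.comp_apply, toWreath_base, toWreath_of_false] at hk
  have h := congrArg RegularWreathProduct.right hk
  rw [diag_right, zpow_right, root, ← ofAdd_zsmul, zsmul_one] at h
  have hdvd : (m : ℤ) ∣ x.down.toAdd :=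
    (ZMod.intCast_zmod_eq_zero_iff_dvd _ _).1 (Multiplicative.ofAdd.injective h).symm
  obtain ⟨t, ht⟩ := hdvd
  refine hx ⟨Multiplicative.ofAdd t, ?_⟩
  change (gen.{u} ^ m) ^ t = x
  apply ULift.down_injective
  apply Multiplicative.toAdd.injective
  simp [gen, ht, mul_comm]

/-- The commutator with `v` of a letter from `G`; letters from the cyclic factor have none. -/
def commutatorWith (v : G) : (Σ b, Factor G b) → Option G
  | ⟨true, (g : G)⟩ => some ⁅g, v⁆
  | ⟨false, _⟩ => none

end RootAmalgam

open PushoutI RootAmalgam in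
theorem mainTheorem10 {G : Type u} [Group G] (p : ℕ) (hp : p.Prime)
    (hfg : Group.FG G) (hG : IsResiduallyFinitePGroup p G)
    (u : G) (hu : ¬ IsOfFinOrder u)
    (hC : Subgroup.centralizer {u} = Subgroup.zpowers u) (n : ℕ) :
    IsResiduallyFinitePGroup p (RootAmalgam u (p ^ n)) := by
  have : Fact p.Prime := ⟨hp⟩
  have : NeZero (p ^ n) := ⟨pow_ne_zero n hp.ne_zero⟩
  have : Finite (Multiplicative (ZMod (p ^ n))) := inferInstanceAs (Finite (ZMod (p ^ n)))
  have hrange (g : G) (hg : ⁅g, u⁆ = 1) : g ∈ (zpowersHom G u).range := by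
    have hmem : g ∈ Subgroup.zpowers u := by
      rw [← hC, Subgroup.mem_centralizer_singleton_iff]
      exact commutatorElement_eq_one_iff_mul_comm.1 hg
    obtain ⟨t, ht⟩ := Subgroup.mem_zpowers_iff.1 hmem
    exact ⟨Multiplicative.ofAdd t, ht⟩
  refine isResiduallyFinitePGroup_of_hom fun h hh => ?_
  obtain ⟨k, w, rfl, hchain, hw⟩ :=
    exists_base_mul_wordProd (toFactor_injective hu (NeZero.ne (p ^ n))) h
  rcases eq_or_ne w [] with rfl | hne
  · have hk : u ^ k.toAdd ≠ 1 := fun h1 => hh (by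
      rw [wordProd_nil, mul_one, ← of_apply_eq_base _ true]
      exact (congrArg (of true) h1).trans (map_one _))
    obtain ⟨P, _, _, f, hP, hf⟩ := hG.exists_hom_forall_mem_list [u ^ k.toAdd] (by simpa using hk)
    refine ⟨_, _, inferInstance, toWreath f u (p ^ n),
      hP.regularWreathProduct (isPGroup_multiplicative_zmod p n), fun h1 => ?_⟩
    rw [wordProd_nil, mul_one, toWreath_base, ← map_zpow] at h1
    exact hf _ (by simp) (RegularWreathProduct.diag_injective (h1.trans (map_one _).symm))
  · have hcomm : ∀ s ∈ w.filterMap (commutatorWith u), s ≠ 1 := by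
      intro s hs
      obtain ⟨⟨b, g⟩, hc, hs⟩ := List.mem_filterMap.1 hs
      cases b with
      | false => cases hs
      | true =>
        cases hs
        exact fun h1 => hw _ hc (hrange g h1)
    obtain ⟨P, _, _, f, hP, hf⟩ := hG.exists_hom_forall_mem_list _ hcomm
    obtain ⟨Q, hgQ, hfQ, ψ, hQ, hψ⟩ := exists_hom_word_notMem
      (hP.regularWreathProduct (isPGroup_multiplicative_zmod p n)) (toWreath f u (p ^ n)) hne hchain
      (by
        rintro ⟨b, g⟩ hc
        cases b with
        | true =>
          exact toWreath_of_true_notMem f u (p ^ n)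
            (hf _ (List.mem_filterMap.2 ⟨⟨true, g⟩, hc, rfl⟩))
        | false => exact toWreath_of_false_notMem f u (p ^ n) (hw _ hc))
    refine ⟨Q, hgQ, hfQ, ψ, hQ, fun h1 => hψ ⟨k⁻¹, ?_⟩⟩
    -- If `u ^ k * w` is killed by `ψ`, then `ψ w` is the image of `u ^ (-k)`.
    rw [map_mul] at h1
    rw [MonoidHom.comp_apply, map_inv, map_inv, inv_eq_of_mul_eq_one_right h1]
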